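/- Let $d$ be an odd prime, $n\ge 0$, and let $\psi$ be a pure state of $n$ qudits, i.e. a unit vector $|\psi\rangle\in(\mathbb{C}^d)^{\otimes n}$. Put $\omega=e^{2\pi i/d}$ and $\tau=e^{(d+1)\pi i/d}$, and let $X|j\rangle=|j+1\rangle$, $Z|j\rangle=\omega^j|j\rangle$ for $j\in\mathbb{Z}_d$. For $u=(a,b)\in\mathbb{Z}_d^n\times\mathbb{Z}_d^n$ let $T_u=\bigotimes_{i=1}^n\tau^{-a_ib_i}Z^{a_i}X^{b_i}$ be the Heisenberg--Weyl operators, $A_0=d^{-n}\sum_u T_u$ and $A_u=T_uA_0T_u^\dagger$ the phase-space point operators, and $W_\psi(u)=d^{-n}\operatorname{tr}(A_u|\psi\rangle\langle\psi|)$ the discrete Wigner function of $\psi$. The Wigner rank $\chi(\psi)$ is the number of $u\in\mathbb{Z}_d^n\times\mathbb{Z}_d^n$ with $W_\psi(u)\neq 0$, and the logarithmic Wigner rank is $\chi_{\log}(\psi)=\log\chi(\psi)-\log d^n$ (logarithms to base $2$). A unitary $U$ on $(\mathbb{C}^d)^{\otimes n}$ is Clifford if for every $u$ there are $\theta\in\mathbb{R}$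 and $u'$ with $UT_uU^\dagger=e^{i\theta}T_{u'}$, and $\psi$ is a (pure) stabilizer state if $|\psi\rangle\langle\psi|=U|0\cdots0\rangle\langle0\cdots0|U^\dagger$ for some Clifford $U$. Then $0\le\chi_{\log}(\psi)\le n\log d$, and $\chi_{\log}(\psi)=0$ if and only if $\psi$ is a stabilizer state. -/

import Mathlib

open scoped Matrix

noncomputable section

namespace Qudit

/-- The label set of the computational basis of `n` qudits. The Hilbert space of `n` qudits is
`EuclideanSpace ℂ (Basis d n)`, with basis vectors `|x₁,…,xₙ⟩`, `xᵢ ∈ ℤ/d`. -/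
abbrev Basis (d n : ℕ) : Type := Fin n → ZMod d

/-- Operators on the Hilbert space of `n` qudits, in the computational basis. -/
abbrev Op (d n : ℕ) : Type := Matrix (Basis d n) (Basis d n) ℂ

/-- The discrete phase space `ℤ_dⁿ × ℤ_dⁿ`. -/
abbrev PhaseSpace (d n : ℕ) : Type := (Fin n → ZMod d) × (Fin n → ZMod d)

/-- `ω = exp(2πi/d)`. -/
def omega (d : ℕ) : ℂ := Complex.exp (2 * Real.pi * Complex.I / d)

/-- `τ = exp((d+1)πi/d)`. -/
def tau (d : ℕ) : ℂ := Complex.exp ((d + 1) * Real.pi * Complex.I / d)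

/-- The shift operator, `X|j⟩ = |j+1⟩`. -/
def shift (d : ℕ) : Matrix (ZMod d) (ZMod d) ℂ :=
  Matrix.of fun i j => if i = j + 1 then 1 else 0

/-- The boost operator, `Z|j⟩ = ω^j|j⟩`. -/
def boost (d : ℕ) : Matrix (ZMod d) (ZMod d) ℂ :=
  Matrix.diagonal fun j => omega d ^ j.val

variable {d n : ℕ} [NeZero d]

/-- The one-qudit Heisenberg-Weyl operator `τ^{-a₁a₂} Z^{a₁} X^{a₂}`. For odd `d` one has
`τ^d = 1`, so the choice of representatives of `a₁` and `a₂` is immaterial. -/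
def weyl₁ (a₁ a₂ : ZMod d) : Matrix (ZMod d) (ZMod d) ℂ :=
  tau d ^ (-((a₁.val : ℤ) * (a₂.val : ℤ))) • (boost d ^ a₁.val * shift d ^ a₂.val)

/-- The `n`-qudit Heisenberg-Weyl operator `T_u`: the tensor (Kronecker) product of the one-qudit
Heisenberg-Weyl operators at `(u.1 i, u.2 i)`. -/
def weyl (u : PhaseSpace d n) : Op d n :=
  Matrix.of fun x y => ∏ i, weyl₁ (u.1 i) (u.2 i) (x i) (y i)

/-- The phase-space point operator at the origin, `A_0 = d^{-n} ∑_u T_u`. -/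
def phasePoint₀ (d n : ℕ) [NeZero d] : Op d n :=
  ((d : ℂ) ^ n)⁻¹ • ∑ u : PhaseSpace d n, weyl u

/-- The phase-space point operators `A_u = T_u A_0 T_u†`. -/
def phasePoint (u : PhaseSpace d n) : Op d n :=
  weyl u * phasePoint₀ d n * (weyl u)ᴴ

/-- The discrete Wigner function `W_M(u) = d^{-n} tr(A_u M)`; its values are real when `M` is
Hermitian. -/
def wigner (M : Op d n) (u : PhaseSpace d n) : ℂ :=
  ((d : ℂ) ^ n)⁻¹ * (phasePoint u * M).trace

/-- The operator `|ψ⟩⟨ψ|`. -/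
def proj (ψ : EuclideanSpace ℂ (Basis d n)) : Op d n :=
  Matrix.of fun x y => ψ x * star (ψ y)

/-- The Wigner set of `|ψ⟩⟨ψ|`. -/
def wignerSet (ψ : EuclideanSpace ℂ (Basis d n)) : Set (PhaseSpace d n) :=
  {u | wigner (proj ψ) u ≠ 0}

/-- The Wigner rank `χ(ψ)`. -/
def wignerRank (ψ : EuclideanSpace ℂ (Basis d n)) : ℕ :=
  (wignerSet ψ).ncard

/-- The logarithmic Wigner rank `log χ(ψ) - log dⁿ`, with logarithms to base 2. -/
def logWignerRank (ψ : EuclideanSpace ℂ (Basis d n)) : ℝ :=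
  Real.logb 2 (wignerRank ψ) - Real.logb 2 ((d : ℝ) ^ n)

/-- Clifford operators: unitaries that map Heisenberg-Weyl operators to Heisenberg-Weyl operators
under conjugation, up to phases. -/
def IsClifford (U : Op d n) : Prop :=
  U ∈ Matrix.unitaryGroup (Basis d n) ℂ ∧
    ∀ u : PhaseSpace d n, ∃ (θ : ℝ) (u' : PhaseSpace d n),
      U * weyl u * Uᴴ = Complex.exp (θ * Complex.I) • weyl u'

/-- The basis vector `|0⟩ = |0,…,0⟩`. -/
def ket0 (d n : ℕ) [NeZero d] : EuclideanSpace ℂ (Basis d n) :=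
  EuclideanSpace.single 0 1

/-- The pure state `ψ` is a stabilizer state: `|ψ⟩⟨ψ| = U|0⟩⟨0|U†` for a Clifford operator `U`. -/
def IsStabilizerState (ψ : EuclideanSpace ℂ (Basis d n)) : Prop :=
  ∃ U : Op d n, IsClifford U ∧ proj ψ = U * proj (ket0 d n) * Uᴴ

end Qudit

end

/-!
The idea is to play the Wigner function of `ψ` off against the subspace `weylStabilizer ψ` of those
phase-space points `w` for which `ψ` is an eigenvector of `T_w`. Since `d` is odd, `2` is invertible
in `ℤ/d`, and with phases `ω^{[u,v]/2}`, where `[u,v]` is the symplectic form, one has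
`T_u T_v = ω^{[u,v]/2} T_{u+v}`. Moreover `A_0` is the parity operator `P` and `A_u = T_{2u} P`, so
the `A_u` are Hermitian unitaries with `∑_u A_u = dⁿ`.

*Bounds.* The expectation values `⟨ψ, A_u ψ⟩ = dⁿ W_ψ(u)` have real part at most `1` and sum to
`dⁿ`, so at least `dⁿ` of them are nonzero; and there are only `d²ⁿ` phase-space points.

*Equality.* The conditions `χ(ψ) = dⁿ`, `dⁿ ≤ |weylStabilizer ψ|` and "`ψ` is a stabilizer state"
are equivalent.

* If `χ(ψ) = dⁿ`, then `⟨ψ, A_u ψ⟩` has real part `1`, hence `A_u ψ = ψ`, on the support of `W_ψ`.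
  As `A_u A_v` is proportional to `T_{2(u-v)}`, the stabilizer contains `dⁿ` points
  (`pow_le_card_weylStabilizer_of_wignerRank_eq`).
* If the stabilizer has `dⁿ` points, then the identity `A_u T_w = ω^{-2[u,w]} T_{-w} A_u` shows
  that `W_ψ` is supported in a coset of the symplectic complement of the stabilizer, which has at
  most `dⁿ` points by a dimension count (`wignerRank_le_of_pow_le_card`).
* The stabilizer is isotropic. If it has `dⁿ` points, it contains one half `e` of a symplectic
  basis `(e, f)` (`exists_symplectic_frame`), and `|x⟩ ↦ T_{f(x)} ψ` is a Clifford operator taking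
  `|0⟩` to `ψ` (`isStabilizerState_of_pow_le_card`).
* Conversely, `U|0⟩` is an eigenvector of the `dⁿ` operators `U T_{(a,0)} U†`
  (`pow_le_card_weylStabilizer_of_isStabilizerState`).
-/

noncomputable section

namespace Qudit

open Matrix

variable {d n : ℕ} [Fact d.Prime]

/-! ### Matrix entries and relations of the Heisenberg-Weyl operators -/

/-- `ω^a` for `a : ℤ/d`, as an additive character with values in `ℂ`. -/
local notation "𝕖" => (ZMod.stdAddChar : AddChar (ZMod _) ℂ)

lemma two_mul_half (hd : Odd d) : (2 : ZMod d) * 2⁻¹ = 1 := by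
  refine mul_inv_cancel₀ fun h => ?_
  have h2 : ((2 : ℕ) : ZMod d) = 0 := by exact_mod_cast h
  rw [ZMod.natCast_eq_zero_iff] at h2
  have h3 := (Nat.prime_dvd_prime_iff_eq (Fact.out : d.Prime) Nat.prime_two).1 h2
  subst h3
  exact absurd hd (by decide)

lemma omega_pow_val (a : ZMod d) : omega d ^ a.val = 𝕖 a := by
  have h : omega d = 𝕖 (1 : ZMod d) := by
    have := ZMod.stdAddChar_coe (N := d) 1
    rw [Int.cast_one] at this
    rw [this, omega]
    push_cast
    congr 1
    ring
  rw [h, ← AddChar.map_nsmul_eq_pow, nsmul_eq_mul, mul_one, ZMod.natCast_zmod_val]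

/-- `τ = ω^{1/2}` with `1/2 ∈ ℤ/d`, because `1/2` is represented by `(d + 1)/2`. -/
lemma tau_eq (hd : Odd d) : tau d = 𝕖 (2⁻¹ : ZMod d) := by
  obtain ⟨m, hm⟩ := hd
  have h : (2⁻¹ : ZMod d) = ((m + 1 : ℤ) : ZMod d) := by
    have h1 := two_mul_half (d := d) ⟨m, hm⟩
    have h2 : (2 * m + 1 : ZMod d) = 0 := by
      have : ((2 * m + 1 : ℕ) : ZMod d) = 0 := by rw [← hm]; simp
      exact_mod_cast this
    push_cast
    linear_combination (m + 1 : ZMod d) * h1 - 2⁻¹ * h2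
  rw [h, ZMod.stdAddChar_coe, tau]
  congr 1
  have : (d : ℂ) = 2 * m + 1 := by exact_mod_cast hm
  rw [this]
  push_cast
  ring

lemma tau_zpow (hd : Odd d) (a b : ZMod d) :
    tau d ^ (-((a.val : ℤ) * (b.val : ℤ))) = 𝕖 (-(2⁻¹ * (a * b))) := by
  rw [tau_eq hd, ← AddChar.map_zsmul_eq_zpow, zsmul_eq_mul]
  push_cast
  rw [ZMod.natCast_zmod_val, ZMod.natCast_zmod_val]
  congr 1
  ring

lemma shift_pow (k : ℕ) (x y : ZMod d) :
    (shift d ^ k) x y = if x = y + k then 1 else 0 := by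
  induction k generalizing x with
  | zero => simp [Matrix.one_apply]
  | succ k ih =>
    rw [pow_succ', Matrix.mul_apply]
    simp only [ih, mul_ite, mul_one, mul_zero]
    rw [Finset.sum_ite_eq']
    simp [shift, add_assoc]

lemma weyl₁_apply (hd : Odd d) (a b x y : ZMod d) :
    weyl₁ a b x y = if x = y + b then 𝕖 (a * x - 2⁻¹ * (a * b)) else 0 := by
  have hp : boost d ^ a.val = Matrix.diagonal fun j => 𝕖 (a * j) := by
    rw [boost, Matrix.diagonal_pow]
    congr 1
    ext j
    rw [Pi.pow_apply, omega_pow_val, ← AddChar.map_nsmul_eq_pow, nsmul_eq_mul,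
      ZMod.natCast_zmod_val]
  rw [weyl₁, hp, tau_zpow hd, Matrix.smul_apply, Matrix.diagonal_mul, shift_pow,
    ZMod.natCast_zmod_val, smul_eq_mul]
  split_ifs
  · rw [mul_one, ← AddChar.map_add_eq_mul]
    congr 1
    ring
  · simp

lemma stdAddChar_sum {ι : Type*} (s : Finset ι) (f : ι → ZMod d) :
    𝕖 (∑ i ∈ s, f i) = ∏ i ∈ s, 𝕖 (f i) := by
  classical
  induction s using Finset.induction_on with
  | empty => simp
  | insert i s hi ih => rw [Finset.sum_insert hi, Finset.prod_insert hi, AddChar.map_add_eq_mul, ih]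

/-- The matrix entries of `T_u`; the phases `τ^{-ab}` become `ω^{-ab/2}`, where `1/2` is taken in
`ℤ/d`. -/
lemma weyl_apply (hd : Odd d) (u : PhaseSpace d n) (x y : Basis d n) :
    weyl u x y = if x = y + u.2 then 𝕖 (u.1 ⬝ᵥ x - 2⁻¹ * (u.1 ⬝ᵥ u.2)) else 0 := by
  simp only [weyl, Matrix.of_apply, weyl₁_apply hd]
  by_cases h : x = y + u.2
  · rw [if_pos h]
    have : ∀ i, x i = y i + u.2 i := fun i => congrFun h i
    rw [Finset.prod_congr rfl fun i _ => if_pos (this i), ← stdAddChar_sum,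
      Finset.sum_sub_distrib, ← Finset.mul_sum]
    rfl
  · rw [if_neg h]
    obtain ⟨i, hi⟩ := Function.ne_iff.1 h
    exact Finset.prod_eq_zero (Finset.mem_univ i) (if_neg hi)

/-- The symplectic form on the discrete phase space. -/
def symp (d n : ℕ) : LinearMap.BilinForm (ZMod d) (PhaseSpace d n) :=
  LinearMap.mk₂ (ZMod d) (fun u v => u.1 ⬝ᵥ v.2 - v.1 ⬝ᵥ u.2)
    (fun u u' v => by simp only [Prod.fst_add, Prod.snd_add, add_dotProduct, dotProduct_add]; ring)
    (fun c u v => by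
      simp only [Prod.smul_fst, Prod.smul_snd, smul_dotProduct, dotProduct_smul, smul_eq_mul]; ring)
    (fun u v v' => by simp only [Prod.fst_add, Prod.snd_add, add_dotProduct, dotProduct_add]; ring)
    (fun c u v => by
      simp only [Prod.smul_fst, Prod.smul_snd, smul_dotProduct, dotProduct_smul, smul_eq_mul]; ring)

lemma symp_apply (u v : PhaseSpace d n) : symp d n u v = u.1 ⬝ᵥ v.2 - v.1 ⬝ᵥ u.2 := rfl

lemma symp_swap (u v : PhaseSpace d n) : symp d n u v = -symp d n v u := by
  rw [symp_apply, symp_apply]; ring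

lemma symp_self (u : PhaseSpace d n) : symp d n u u = 0 := by
  rw [symp_apply, sub_self]

lemma weyl_zero (hd : Odd d) : weyl (0 : PhaseSpace d n) = 1 := by
  ext x y
  rw [weyl_apply hd]
  simp [Matrix.one_apply]

lemma weyl_mul (hd : Odd d) (u v : PhaseSpace d n) :
    weyl u * weyl v = 𝕖 (2⁻¹ * symp d n u v) • weyl (u + v) := by
  ext x y
  have h2 := two_mul_half hd
  simp only [Matrix.mul_apply, Matrix.smul_apply, smul_eq_mul, weyl_apply hd, mul_ite, mul_zero,
    Finset.sum_ite_eq', Finset.mem_univ, if_true]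
  by_cases h : x = y + v.2 + u.2
  · have h' : x = y + (u + v).2 := by rw [h, Prod.snd_add]; abel
    rw [if_pos h, if_pos h', ← AddChar.map_add_eq_mul, ← AddChar.map_add_eq_mul, symp_apply]
    have hx : y + v.2 = x - u.2 := by rw [h]; abel
    rw [hx]
    congr 1
    simp only [Prod.fst_add, Prod.snd_add, add_dotProduct, dotProduct_add, dotProduct_sub]
    linear_combination (v.1 ⬝ᵥ u.2) * h2
  · have h' : ¬ x = y + (u + v).2 := fun e => h (by rw [e, Prod.snd_add]; abel)
    rw [if_neg h, if_neg h', zero_mul]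

lemma star_stdAddChar (a : ZMod d) : star (𝕖 a) = 𝕖 (-a) := by
  rw [AddChar.map_neg_eq_conj]; rfl

lemma stdAddChar_ne_zero (a : ZMod d) : 𝕖 a ≠ 0 := by
  intro h
  have := AddChar.map_add_eq_mul 𝕖 a (-a)
  simp [h] at this

lemma weyl_conjTranspose (hd : Odd d) (u : PhaseSpace d n) : (weyl u)ᴴ = weyl (-u) := by
  ext x y
  have h2 := two_mul_half hd
  rw [Matrix.conjTranspose_apply, weyl_apply hd, weyl_apply hd]
  by_cases h : y = x + u.2
  · have h' : x = y + (-u).2 := by rw [h, Prod.snd_neg]; abel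
    rw [if_pos h, if_pos h', star_stdAddChar, h]
    congr 1
    simp only [Prod.fst_neg, Prod.snd_neg, neg_dotProduct, dotProduct_neg, dotProduct_add]
    linear_combination (u.1 ⬝ᵥ u.2) * h2
  · have h' : ¬ x = y + (-u).2 := fun e => h (by rw [e, Prod.snd_neg]; abel)
    rw [if_neg h, if_neg h', star_zero]

lemma weyl_mul_neg (hd : Odd d) (u : PhaseSpace d n) : weyl u * weyl (-u) = 1 := by
  rw [weyl_mul hd, map_neg, symp_self, add_neg_cancel, weyl_zero hd]
  simp

lemma weyl_mul_comm (hd : Odd d) (u v : PhaseSpace d n) :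
    weyl u * weyl v = 𝕖 (symp d n u v) • (weyl v * weyl u) := by
  rw [weyl_mul hd, weyl_mul hd, smul_smul, ← AddChar.map_add_eq_mul, add_comm v, symp_swap v]
  congr 2
  linear_combination (symp d n u v) * two_mul_half hd

/-! ### Phase-space point operators -/

/-- The parity operator `|x⟩ ↦ |-x⟩`. -/
def parity (d n : ℕ) : Op d n := Matrix.of fun x y => if x = -y then 1 else 0

/-- Orthogonality of the characters of `(ℤ/d)ⁿ`. -/
lemma sum_stdAddChar_dotProduct (y : Basis d n) :
    ∑ a : Basis d n, 𝕖 (a ⬝ᵥ y) = if y = 0 then (d : ℂ) ^ n else 0 := by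
  by_cases h : y = 0
  · simp [h, ZMod.card]
  · rw [if_neg h]
    let χ : AddChar (Basis d n) ℂ :=
      { toFun := fun a => 𝕖 (a ⬝ᵥ y)
        map_zero_eq_one' := by simp
        map_add_eq_mul' := fun a b => by rw [add_dotProduct, AddChar.map_add_eq_mul] }
    obtain ⟨i, hi⟩ := Function.ne_iff.1 h
    refine AddChar.sum_eq_zero_of_ne_one (ψ := χ) fun hχ => hi ?_
    have h1 : χ (Pi.single i 1) = 1 := by rw [hχ]; rfl
    have h2 : 𝕖 (y i) = 𝕖 (0 : ZMod d) := by
      rw [AddChar.map_zero_eq_one, ← h1]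
      simp [χ]
    exact ZMod.injective_stdAddChar h2

lemma pow_card_ne_zero : (d : ℂ) ^ n ≠ 0 :=
  pow_ne_zero _ (Nat.cast_ne_zero.2 (Fact.out : d.Prime).ne_zero)

/-- Summing over the first coordinate of `u = (a, b)` in `d⁻ⁿ ∑_u T_u` leaves the entries with
`x = b / 2`, where `b = x - y`, that is `x = -y`. -/
lemma phasePoint₀_eq_parity (hd : Odd d) : phasePoint₀ d n = parity d n := by
  ext x y
  have h2 := two_mul_half hd
  have key : ∑ u : PhaseSpace d n, weyl u x y
      = ∑ a : Basis d n, 𝕖 (a ⬝ᵥ (x - (2⁻¹ : ZMod d) • (x - y))) := by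
    rw [Fintype.sum_prod_type]
    refine Finset.sum_congr rfl fun a _ => ?_
    have : ∀ b : Basis d n, weyl (a, b) x y =
        if b = x - y then 𝕖 (a ⬝ᵥ (x - (2⁻¹ : ZMod d) • (x - y))) else 0 := by
      intro b
      rw [weyl_apply hd]
      by_cases h : b = x - y
      · rw [if_pos h, if_pos (by rw [h]; simp), h]
        simp only [dotProduct_sub, dotProduct_smul, smul_eq_mul]
      · rw [if_neg h, if_neg fun e => h (by rw [e]; simp)]
    simp [this]
  have hxy : x - (2⁻¹ : ZMod d) • (x - y) = 0 ↔ x = -y := by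
    constructor
    · intro h
      funext i
      have hi := congrFun h i
      simp only [Pi.sub_apply, Pi.smul_apply, smul_eq_mul, Pi.zero_apply] at hi
      rw [Pi.neg_apply]
      linear_combination 2 * hi + (x i - y i) * h2
    · intro h
      funext i
      simp only [h, Pi.sub_apply, Pi.smul_apply, smul_eq_mul, Pi.zero_apply, Pi.neg_apply]
      linear_combination (y i) * h2
  rw [phasePoint₀, Matrix.smul_apply, Matrix.sum_apply, key, sum_stdAddChar_dotProduct, parity,
    Matrix.of_apply, smul_eq_mul, mul_ite, mul_zero, inv_mul_cancel₀ pow_card_ne_zero]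
  simp only [hxy]

lemma parity_mul_parity : parity d n * parity d n = 1 := by
  ext x y
  simp [Matrix.mul_apply, parity, Matrix.one_apply]

lemma parity_conjTranspose : (parity d n)ᴴ = parity d n := by
  ext x y
  simp only [parity, Matrix.conjTranspose_apply, Matrix.of_apply, apply_ite star, star_one,
    star_zero]
  simp only [eq_neg_iff_add_eq_zero, add_comm]

lemma parity_mul_weyl (hd : Odd d) (u : PhaseSpace d n) :
    parity d n * weyl u = weyl (-u) * parity d n := by
  ext x y
  simp only [Matrix.mul_apply, parity, Matrix.of_apply, ite_mul, one_mul, zero_mul, mul_ite,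
    mul_one, mul_zero, Finset.sum_ite_eq']
  have : ∀ z : Basis d n, x = -z ↔ z = -x := fun z =>
    ⟨fun h => by rw [h, neg_neg], fun h => by rw [h, neg_neg]⟩
  simp only [this, Finset.sum_ite_eq', Finset.mem_univ, if_true, weyl_apply hd]
  have h' : -x = y + u.2 ↔ x = -y + (-u).2 := by
    rw [neg_eq_iff_eq_neg, neg_add, Prod.snd_neg]
  simp [h']

lemma phasePoint_eq (hd : Odd d) (u : PhaseSpace d n) :
    phasePoint u = weyl (u + u) * parity d n := by
  rw [phasePoint, phasePoint₀_eq_parity hd, weyl_conjTranspose hd, Matrix.mul_assoc,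
    parity_mul_weyl hd, neg_neg, ← Matrix.mul_assoc, weyl_mul hd, symp_self]
  simp

lemma phasePoint_conjTranspose (hd : Odd d) (u : PhaseSpace d n) :
    (phasePoint u)ᴴ = phasePoint u := by
  rw [phasePoint_eq hd, Matrix.conjTranspose_mul, parity_conjTranspose, weyl_conjTranspose hd,
    parity_mul_weyl hd, neg_neg]

/-- The product of two phase-space point operators is, up to a phase, a Heisenberg-Weyl
operator. -/
lemma phasePoint_mul_phasePoint (hd : Odd d) (u v : PhaseSpace d n) :
    ∃ c : ℂ, phasePoint u * phasePoint v = c • weyl ((2 : ZMod d) • (u - v)) := by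
  refine ⟨𝕖 (2⁻¹ * symp d n (u + u) (-(v + v))), ?_⟩
  rw [phasePoint_eq hd, phasePoint_eq hd, Matrix.mul_assoc, ← Matrix.mul_assoc (parity d n),
    parity_mul_weyl hd, Matrix.mul_assoc, parity_mul_parity, Matrix.mul_one, weyl_mul hd, two_smul]
  congr 2
  abel

lemma phasePoint_mul_self (hd : Odd d) (u : PhaseSpace d n) :
    phasePoint u * phasePoint u = 1 := by
  rw [phasePoint_eq hd, Matrix.mul_assoc, ← Matrix.mul_assoc (parity d n),
    parity_mul_weyl hd, Matrix.mul_assoc, parity_mul_parity, Matrix.mul_one, weyl_mul_neg hd]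

/-- Commuting a phase-space point operator past a Heisenberg-Weyl operator reflects the label of
the latter. -/
lemma phasePoint_mul_weyl (hd : Odd d) (u w : PhaseSpace d n) :
    phasePoint u * weyl w = 𝕖 (-(2 * symp d n u w)) • (weyl (-w) * phasePoint u) := by
  rw [phasePoint_eq hd, Matrix.mul_assoc, parity_mul_weyl hd, ← Matrix.mul_assoc,
    weyl_mul_comm hd, Matrix.smul_mul, Matrix.mul_assoc]
  congr 2
  simp only [map_add, map_neg, LinearMap.add_apply]
  ring

/-- As `u ↦ 2u` is a bijection, `∑_u T_{2u} P = ∑_u T_u P = dⁿ A_0 P = dⁿ`. -/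
lemma sum_phasePoint (hd : Odd d) :
    ∑ u : PhaseSpace d n, phasePoint u = (d : ℂ) ^ n • (1 : Op d n) := by
  have h2 := two_mul_half hd
  have hinj : Function.Injective fun b : Basis d n => b + b := by
    intro b b' h
    funext i
    have := congrFun h i
    simp only [Pi.add_apply] at this
    linear_combination (2⁻¹ : ZMod d) * this - (b i - b' i) * h2
  have hbij : Function.Bijective fun u : PhaseSpace d n => u + u := by
    refine Finite.injective_iff_bijective.1 fun u v h => ?_
    exact Prod.ext (hinj (congrArg Prod.fst h)) (hinj (congrArg Prod.snd h))
  have hw : ∑ u : PhaseSpace d n, weyl u = (d : ℂ) ^ n • parity d n := by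
    rw [← phasePoint₀_eq_parity hd, phasePoint₀, smul_smul, mul_inv_cancel₀ pow_card_ne_zero,
      one_smul]
  simp only [phasePoint_eq hd]
  rw [← Finset.sum_mul, hbij.sum_comp (fun u => weyl u), hw, Matrix.smul_mul, parity_mul_parity]

/-! ### Linear algebra of the symplectic form -/

lemma symp_ker : LinearMap.ker (symp d n) = ⊥ := by
  refine LinearMap.ker_eq_bot'.2 fun u hu => ?_
  have h : ∀ v, symp d n u v = 0 := fun v => by rw [hu]; rfl
  refine Prod.ext (funext fun i => ?_) (funext fun i => ?_)
  · simpa [symp_apply] using h (0, Pi.single i 1)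
  · simpa [symp_apply] using h (Pi.single i 1, 0)

lemma symp_nondegenerate : (symp d n).Nondegenerate := by
  refine LinearMap.BilinForm.nondegenerate_iff_ker_eq_bot.2 symp_ker

lemma card_submodule (L : Submodule (ZMod d) (PhaseSpace d n)) :
    Nat.card L = d ^ Module.finrank (ZMod d) L := by
  rw [Module.natCard_eq_pow_finrank (K := ZMod d), Nat.card_zmod]

lemma le_finrank_of_pow_le_card {L : Submodule (ZMod d) (PhaseSpace d n)}
    (h : d ^ n ≤ Nat.card L) : n ≤ Module.finrank (ZMod d) L := by
  rw [card_submodule] at h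
  exact (Nat.pow_le_pow_iff_right (Fact.out : d.Prime).one_lt).1 h

lemma card_orthogonal_le {L : Submodule (ZMod d) (PhaseSpace d n)} (h : d ^ n ≤ Nat.card L) :
    Nat.card ((symp d n).orthogonal L) ≤ d ^ n := by
  rw [card_submodule]
  refine Nat.pow_le_pow_right (Fact.out : d.Prime).pos ?_
  rw [LinearMap.BilinForm.finrank_orthogonal symp_nondegenerate, Module.finrank_prod,
    Module.finrank_fin_fun]
  have := le_finrank_of_pow_le_card h
  omega

/-- An isotropic subspace with at least `dⁿ` elements contains one half `e` of a symplectic basis.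
A dual family `f₀` is given by nondegeneracy; subtracting from it half of its component along `e`
makes it isotropic, which is where `2` has to be invertible. -/
lemma exists_symplectic_frame (hd : Odd d) {L : Submodule (ZMod d) (PhaseSpace d n)}
    (hL : ∀ u ∈ L, ∀ v ∈ L, symp d n u v = 0) (hcard : d ^ n ≤ Nat.card L) :
    ∃ e f : (Fin n → ZMod d) →ₗ[ZMod d] PhaseSpace d n, (∀ a, e a ∈ L) ∧
      (∀ a b, symp d n (e a) (f b) = a ⬝ᵥ b) ∧ ∀ a b, symp d n (f a) (f b) = 0 := by
  obtain ⟨b, hb⟩ := exists_linearIndependent_of_le_finrank (le_finrank_of_pow_le_card hcard)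
  let e : (Fin n → ZMod d) →ₗ[ZMod d] PhaseSpace d n :=
    L.subtype ∘ₗ Fintype.linearCombination (ZMod d) b
  have he : ∀ a, e a ∈ L := fun a => (Fintype.linearCombination (ZMod d) b a).2
  have hinj : LinearMap.ker e = ⊥ := by
    rw [LinearMap.ker_comp_of_ker_eq_bot _ L.ker_subtype]
    exact LinearMap.ker_eq_bot.2 (linearIndependent_iff_injective_fintypeLinearCombination.1 hb)
  obtain ⟨g, hg⟩ := e.exists_leftInverse_of_injective hinj
  have hge : ∀ a, g (e a) = a := fun a => LinearMap.congr_fun hg a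
  let φ : (Fin n → ZMod d) →ₗ[ZMod d] Module.Dual (ZMod d) (PhaseSpace d n) :=
    LinearMap.mk₂ (ZMod d) (fun b v => g v ⬝ᵥ b) (fun b b' v => by rw [dotProduct_add])
      (fun c b v => by rw [dotProduct_smul]) (fun b v v' => by rw [map_add, add_dotProduct])
      (fun c b v => by rw [map_smul, smul_dotProduct])
  let f₀ : (Fin n → ZMod d) →ₗ[ZMod d] PhaseSpace d n :=
    -(((symp d n).toDual symp_nondegenerate).symm.toLinearMap ∘ₗ φ)
  have hf₀ : ∀ v b, symp d n v (f₀ b) = g v ⬝ᵥ b := by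
    intro v b
    rw [symp_swap, ← LinearMap.neg_apply, ← map_neg]
    simp only [f₀, LinearMap.neg_apply, neg_neg, LinearMap.comp_apply, LinearEquiv.coe_coe,
      LinearMap.BilinForm.apply_toDual_symm_apply]
    rfl
  refine ⟨e, f₀ - (2⁻¹ : ZMod d) • (e ∘ₗ g ∘ₗ f₀), he, fun a b => ?_, fun a b => ?_⟩
  · simp only [LinearMap.sub_apply, LinearMap.smul_apply, LinearMap.comp_apply, map_sub, map_smul,
      hf₀, hge, hL _ (he _) _ (he _), smul_zero, sub_zero]
  · have h1 : symp d n (f₀ a) (e (g (f₀ b))) = symp d n (f₀ a) (f₀ b) := by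
      rw [symp_swap, hf₀, hge, ← hf₀, symp_swap, neg_neg]
    have h2 : symp d n (e (g (f₀ a))) (f₀ b) = symp d n (f₀ a) (f₀ b) := by
      rw [hf₀, hge, ← hf₀]
    simp only [LinearMap.sub_apply, LinearMap.smul_apply, LinearMap.comp_apply, map_sub, map_smul,
      hL _ (he _) _ (he _), h1, h2, smul_eq_mul]
    linear_combination (-symp d n (f₀ a) (f₀ b)) * two_mul_half hd

/-! ### Expectation values -/

lemma wigner_proj (ψ : EuclideanSpace ℂ (Basis d n)) (u : PhaseSpace d n) :
    wigner (proj ψ) u = ((d : ℂ) ^ n)⁻¹ * (star ψ.ofLp ⬝ᵥ phasePoint u *ᵥ ψ.ofLp) := by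
  have : proj ψ = vecMulVec ψ.ofLp (star ψ.ofLp) := rfl
  rw [wigner, this, mul_vecMulVec, trace_vecMulVec, dotProduct_comm]

lemma star_dotProduct_self_of_norm_eq_one {ψ : EuclideanSpace ℂ (Basis d n)} (hψ : ‖ψ‖ = 1) :
    star ψ.ofLp ⬝ᵥ ψ.ofLp = 1 := by
  have := inner_self_eq_norm_sq_to_K (𝕜 := ℂ) ψ
  rw [EuclideanSpace.inner_eq_star_dotProduct, hψ, dotProduct_comm] at this
  simpa using this

lemma star_dotProduct_mulVec_left (A : Op d n) (φ ψ : Basis d n → ℂ) :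
    star (A *ᵥ φ) ⬝ᵥ ψ = star φ ⬝ᵥ (Aᴴ *ᵥ ψ) := by
  rw [star_mulVec, ← dotProduct_mulVec]

open scoped ComplexOrder in
/-- If `A` is unitary and `ψ` a unit vector, then `Re ⟨ψ, A ψ⟩ ≤ 1`, with equality only if
`A ψ = ψ`: the difference of the two sides is `‖A ψ - ψ‖² / 2`. -/
lemma re_expectation_le_one {A : Op d n} (hA : Aᴴ * A = 1) {ψ : Basis d n → ℂ}
    (hψ : star ψ ⬝ᵥ ψ = 1) :
    (star ψ ⬝ᵥ A *ᵥ ψ).re ≤ 1 ∧ ((star ψ ⬝ᵥ A *ᵥ ψ).re = 1 → A *ᵥ ψ = ψ) := by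
  have h1 : star (A *ᵥ ψ) ⬝ᵥ (A *ᵥ ψ) = 1 := by
    rw [star_dotProduct_mulVec_left, mulVec_mulVec, hA, one_mulVec, hψ]
  have h2 : star (A *ᵥ ψ) ⬝ᵥ ψ = star (star ψ ⬝ᵥ A *ᵥ ψ) := by
    rw [star_dotProduct]
  have h3 : star (A *ᵥ ψ - ψ) ⬝ᵥ (A *ᵥ ψ - ψ) = ((2 - 2 * (star ψ ⬝ᵥ A *ᵥ ψ).re : ℝ) : ℂ) := by
    rw [star_sub, sub_dotProduct, dotProduct_sub, dotProduct_sub, h1, h2, hψ]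
    apply Complex.ext <;> simp
    ring
  constructor
  · have := dotProduct_star_self_nonneg (A *ᵥ ψ - ψ)
    rw [h3] at this
    have := Complex.zero_le_real.1 this
    linarith
  · intro h
    rw [h] at h3
    refine sub_eq_zero.1 (dotProduct_star_self_eq_zero.1 ?_)
    rw [h3]; norm_num

/-! ### The stabilizer of a vector -/

/-- The subspace of those `w` for which `ψ` is an eigenvector of `T_w`. A nonzero
eigenvalue is part of the definition, so that closure under negation needs no condition on `ψ`; for
a unit vector `ψ` it is automatic (`mem_weylStabilizer`). -/
def weylStabilizer (hd : Odd d) (ψ : Basis d n → ℂ) : Submodule (ZMod d) (PhaseSpace d n) :=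
  AddSubgroup.toZModSubmodule d
    { carrier := {w | ∃ c : ℂ, c ≠ 0 ∧ weyl w *ᵥ ψ = c • ψ}
      zero_mem' := ⟨1, one_ne_zero, by rw [weyl_zero hd, one_mulVec, one_smul]⟩
      add_mem' := by
        rintro u v ⟨c, hc, hu⟩ ⟨c', hc', hv⟩
        refine ⟨𝕖 (-(2⁻¹ * symp d n u v)) * (c' * c),
          mul_ne_zero (stdAddChar_ne_zero _) (mul_ne_zero hc' hc), ?_⟩
        have h : weyl (u + v) = 𝕖 (-(2⁻¹ * symp d n u v)) • (weyl u * weyl v) := by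
          rw [weyl_mul hd, smul_smul, ← AddChar.map_add_eq_mul, neg_add_cancel,
            AddChar.map_zero_eq_one, one_smul]
        rw [h, smul_mulVec, ← mulVec_mulVec, hv, mulVec_smul, hu, smul_smul, smul_smul, mul_assoc]
      neg_mem' := by
        rintro u ⟨c, hc, hu⟩
        refine ⟨c⁻¹, inv_ne_zero hc, ?_⟩
        have h : weyl (-u) *ᵥ (weyl u *ᵥ ψ) = ψ := by
          have := weyl_mul_neg hd (-u)
          rw [neg_neg] at this
          rw [mulVec_mulVec, this, one_mulVec]
        rw [hu, mulVec_smul] at h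
        rw [eq_inv_smul_iff₀ hc, h] }

lemma weyl_conjTranspose_mul_self (hd : Odd d) (u : PhaseSpace d n) :
    (weyl u)ᴴ * weyl u = 1 := by
  have := weyl_mul_neg hd (-u)
  rwa [neg_neg, ← weyl_conjTranspose hd] at this

lemma star_mul_self_eq_one_of_eigen {A : Op d n} (hA : Aᴴ * A = 1) {ψ : Basis d n → ℂ}
    (hψ : star ψ ⬝ᵥ ψ = 1) {c : ℂ} (h : A *ᵥ ψ = c • ψ) : star c * c = 1 := by
  have h1 : star (A *ᵥ ψ) ⬝ᵥ (A *ᵥ ψ) = 1 := by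
    rw [star_dotProduct_mulVec_left, mulVec_mulVec, hA, one_mulVec, hψ]
  rwa [h, star_smul, smul_dotProduct, dotProduct_smul, hψ, smul_eq_mul, smul_eq_mul, mul_one] at h1

lemma mem_weylStabilizer (hd : Odd d) {ψ : Basis d n → ℂ} (hψ : star ψ ⬝ᵥ ψ = 1)
    {w : PhaseSpace d n} : w ∈ weylStabilizer hd ψ ↔ ∃ c : ℂ, weyl w *ᵥ ψ = c • ψ := by
  refine ⟨fun ⟨c, _, h⟩ => ⟨c, h⟩, fun ⟨c, h⟩ => ⟨c, ?_, h⟩⟩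
  rintro rfl
  have := star_mul_self_eq_one_of_eigen (weyl_conjTranspose_mul_self hd w) hψ h
  simp at this

lemma ne_zero_of_star_dotProduct_self {ψ : Basis d n → ℂ} (hψ : star ψ ⬝ᵥ ψ = 1) : ψ ≠ 0 := by
  rintro rfl
  simp at hψ

/-- Heisenberg-Weyl operators with a common eigenvector commute. -/
lemma symp_eq_zero_of_mem_weylStabilizer (hd : Odd d) {ψ : Basis d n → ℂ}
    (hψ : star ψ ⬝ᵥ ψ = 1) {u v : PhaseSpace d n} (hu : u ∈ weylStabilizer hd ψ)
    (hv : v ∈ weylStabilizer hd ψ) : symp d n u v = 0 := by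
  obtain ⟨c, hc, hu⟩ := hu
  obtain ⟨c', hc', hv⟩ := hv
  have h := congrArg (· *ᵥ ψ) (weyl_mul_comm hd u v)
  simp only [smul_mulVec, ← mulVec_mulVec, hu, hv, mulVec_smul, smul_smul] at h
  have h' := smul_left_injective ℂ (ne_zero_of_star_dotProduct_self hψ) h
  apply ZMod.injective_stdAddChar
  rw [AddChar.map_zero_eq_one]
  refine mul_right_cancel₀ (mul_ne_zero hc hc') ?_
  linear_combination -h'

/-! ### Wigner rank and stabilizer -/

/-- The expectation value `⟨ψ, A_u ψ⟩ = dⁿ W_ψ(u)`. -/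
def expectation (ψ : Basis d n → ℂ) (u : PhaseSpace d n) : ℂ :=
  star ψ ⬝ᵥ phasePoint u *ᵥ ψ

lemma mem_wignerSet {ψ : EuclideanSpace ℂ (Basis d n)} {u : PhaseSpace d n} :
    u ∈ wignerSet ψ ↔ expectation ψ.ofLp u ≠ 0 := by
  rw [wignerSet, Set.mem_ofPred_eq, wigner_proj, expectation, mul_ne_zero_iff,
    and_iff_right (inv_ne_zero pow_card_ne_zero)]

lemma sum_expectation (hd : Odd d) {ψ : Basis d n → ℂ} (hψ : star ψ ⬝ᵥ ψ = 1) :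
    ∑ u, expectation ψ u = (d : ℂ) ^ n := by
  simp only [expectation]
  rw [← dotProduct_sum, ← sum_mulVec, sum_phasePoint hd, smul_mulVec, one_mulVec, dotProduct_smul,
    hψ, smul_eq_mul, mul_one]

lemma phasePoint_conjTranspose_mul_self (hd : Odd d) (u : PhaseSpace d n) :
    (phasePoint u)ᴴ * phasePoint u = 1 := by
  rw [phasePoint_conjTranspose hd, phasePoint_mul_self hd]

open Classical in
/-- Over the support of the Wigner function, the defects `1 - dⁿ Re W_ψ(u) ≥ 0` sum to
`χ(ψ) - dⁿ`. -/
lemma sum_one_sub_re_expectation (hd : Odd d) {ψ : EuclideanSpace ℂ (Basis d n)} (hψ : ‖ψ‖ = 1) :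
    ∑ u ∈ (wignerSet ψ).toFinset, (1 - (expectation ψ.ofLp u).re) =
      (wignerRank ψ : ℝ) - (d : ℝ) ^ n := by
  have h1 : ∑ u ∈ (wignerSet ψ).toFinset, expectation ψ.ofLp u = (d : ℂ) ^ n := by
    rw [← sum_expectation hd (star_dotProduct_self_of_norm_eq_one hψ)]
    refine Finset.sum_subset (Finset.subset_univ _) fun u _ hu => ?_
    rw [Set.mem_toFinset, mem_wignerSet, not_not] at hu
    exact hu
  have h2 := congrArg Complex.re h1
  rw [Complex.re_sum, ← Complex.ofReal_natCast, ← Complex.ofReal_pow, Complex.ofReal_re] at h2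
  rw [Finset.sum_sub_distrib, h2, Finset.sum_const, nsmul_one, wignerRank,
    Set.ncard_eq_toFinset_card']

lemma re_expectation_le (hd : Odd d) {ψ : EuclideanSpace ℂ (Basis d n)} (hψ : ‖ψ‖ = 1)
    (u : PhaseSpace d n) : (expectation ψ.ofLp u).re ≤ 1 :=
  (re_expectation_le_one (phasePoint_conjTranspose_mul_self hd u)
    (star_dotProduct_self_of_norm_eq_one hψ)).1

/-- The lower bound `dⁿ ≤ χ(ψ)` holds because the defects are nonnegative. -/
lemma pow_le_wignerRank (hd : Odd d) {ψ : EuclideanSpace ℂ (Basis d n)} (hψ : ‖ψ‖ = 1) :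
    d ^ n ≤ wignerRank ψ := by
  classical
  have h := sum_one_sub_re_expectation hd hψ
  have h0 : 0 ≤ ∑ u ∈ (wignerSet ψ).toFinset, (1 - (expectation ψ.ofLp u).re) :=
    Finset.sum_nonneg fun u _ => sub_nonneg.2 (re_expectation_le hd hψ u)
  rw [h] at h0
  exact_mod_cast sub_nonneg.1 h0

/-- If the Wigner rank is minimal, then `A_u ψ = ψ` on the support `S` of the Wigner function, so
`ψ` is an eigenvector of the operators `A_u A_s` with `u, s ∈ S`, which are proportional to
`T_{2(u - s)}`. -/
lemma pow_le_card_weylStabilizer_of_wignerRank_eq (hd : Odd d)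
    {ψ : EuclideanSpace ℂ (Basis d n)} (hψ : ‖ψ‖ = 1) (hr : wignerRank ψ = d ^ n) :
    d ^ n ≤ Nat.card (weylStabilizer hd ψ.ofLp) := by
  classical
  have hψ' := star_dotProduct_self_of_norm_eq_one hψ
  have hfix : ∀ u ∈ wignerSet ψ, phasePoint u *ᵥ ψ.ofLp = ψ.ofLp := by
    intro u hu
    have h := sum_one_sub_re_expectation hd hψ
    rw [hr, Nat.cast_pow, sub_self,
      Finset.sum_eq_zero_iff_of_nonneg fun u _ => sub_nonneg.2 (re_expectation_le hd hψ u)] at h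
    exact (re_expectation_le_one (phasePoint_conjTranspose_mul_self hd u) hψ').2
      (sub_eq_zero.1 (h u (Set.mem_toFinset.2 hu))).symm
  have hne : (wignerSet ψ).Nonempty := by
    rw [← Set.ncard_pos, ← wignerRank, hr]
    exact pow_pos (Fact.out : d.Prime).pos n
  obtain ⟨s, hs⟩ := hne
  have hmem : ∀ u ∈ wignerSet ψ, (2 : ZMod d) • (u - s) ∈ weylStabilizer hd ψ.ofLp := by
    intro u hu
    obtain ⟨c, hc⟩ := phasePoint_mul_phasePoint hd u s
    have h1 : c • (weyl ((2 : ZMod d) • (u - s)) *ᵥ ψ.ofLp) = ψ.ofLp := by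
      rw [← smul_mulVec, ← hc, ← mulVec_mulVec, hfix s hs, hfix u hu]
    have hc0 : c ≠ 0 := by
      rintro rfl
      rw [zero_smul] at h1
      exact ne_zero_of_star_dotProduct_self hψ' h1.symm
    exact (mem_weylStabilizer hd hψ').2 ⟨c⁻¹, by rw [eq_inv_smul_iff₀ hc0, h1]⟩
  rw [← hr, wignerRank, ← SetLike.coe_sort_coe, Nat.card_coe_set_eq]
  refine Set.ncard_le_ncard_of_injOn (fun u => (2 : ZMod d) • (u - s)) hmem ?_
  intro u _ v _ h
  have h20 : (2 : ZMod d) ≠ 0 := left_ne_zero_of_mul_eq_one (two_mul_half hd)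
  exact sub_left_injective (smul_right_injective _ h20 h)

/-- On the support of the Wigner function, the symplectic product with `w` in the stabilizer is
determined by the eigenvalue of `T_w`; so the support lies in a coset of the symplectic complement
of the stabilizer. -/
lemma wignerRank_le_of_pow_le_card (hd : Odd d)
    {ψ : EuclideanSpace ℂ (Basis d n)}
    (hcard : d ^ n ≤ Nat.card (weylStabilizer hd ψ.ofLp)) : wignerRank ψ ≤ d ^ n := by
  rcases (wignerSet ψ).eq_empty_or_nonempty with h | ⟨s, hs⟩
  · rw [wignerRank, h, Set.ncard_empty]
    exact Nat.zero_le _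
  have key : ∀ u ∈ wignerSet ψ, ∀ w c, weyl w *ᵥ ψ.ofLp = c • ψ.ofLp →
      c = 𝕖 (-(2 * symp d n u w)) * star c := by
    intro u hu w c hw
    have h1 : star ψ.ofLp ⬝ᵥ ((phasePoint u * weyl w) *ᵥ ψ.ofLp) = c * expectation ψ.ofLp u := by
      rw [← mulVec_mulVec, hw, mulVec_smul, dotProduct_smul, smul_eq_mul, expectation]
    have h2 : star ψ.ofLp ⬝ᵥ ((weyl (-w) * phasePoint u) *ᵥ ψ.ofLp) =
        star c * expectation ψ.ofLp u := by
      rw [← mulVec_mulVec, ← weyl_conjTranspose hd, ← star_dotProduct_mulVec_left, hw, star_smul,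
        smul_dotProduct, smul_eq_mul, expectation]
    rw [phasePoint_mul_weyl hd, smul_mulVec, dotProduct_smul, h2, smul_eq_mul, ← mul_assoc] at h1
    exact (mul_right_cancel₀ (mem_wignerSet.1 hu) h1).symm
  have hmem : ∀ u ∈ wignerSet ψ,
      u - s ∈ (symp d n).orthogonal (weylStabilizer hd ψ.ofLp) := by
    rintro u hu w ⟨c, hc, hw⟩
    have h := (key u hu w c hw).symm.trans (key s hs w c hw)
    have h' := ZMod.injective_stdAddChar (mul_right_cancel₀ (star_ne_zero.2 hc) h)
    change symp d n w (u - s) = 0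
    rw [symp_swap, map_sub, LinearMap.sub_apply]
    linear_combination (2⁻¹ : ZMod d) * h' +
      (symp d n u w - symp d n s w) * two_mul_half hd
  refine le_trans ?_ (card_orthogonal_le hcard)
  rw [wignerRank, ← SetLike.coe_sort_coe, Nat.card_coe_set_eq]
  exact Set.ncard_le_ncard_of_injOn (fun u => u - s) hmem fun u _ v _ h => sub_left_injective h

/-! ### Stabilizer states -/

lemma proj_ket0_mulVec_conj (U : Op d n) :
    U * proj (ket0 d n) * Uᴴ = vecMulVec (U *ᵥ Pi.single 0 1) (star (U *ᵥ Pi.single 0 1)) := by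
  have : proj (ket0 d n) = vecMulVec (Pi.single 0 1) (star (Pi.single 0 1)) := rfl
  rw [this, mul_vecMulVec, vecMulVec_mul, star_mulVec]

lemma weyl_fst_mulVec_single (hd : Odd d) (a : Basis d n) :
    weyl ((a, 0) : PhaseSpace d n) *ᵥ Pi.single 0 1 = Pi.single 0 1 := by
  ext x
  rw [mulVec_single_one, Matrix.col_apply, weyl_apply hd]
  by_cases h : x = 0
  · subst h; simp
  · simp [h]

/-- `T_a` and `T_b` are proportional for no two points `a ≠ b` of `ℤ_dⁿ × 0`. -/
lemma eq_of_weyl_fst_eq_smul (hd : Odd d) {a b : Basis d n} {c : ℂ}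
    (h : weyl ((a, 0) : PhaseSpace d n) = c • weyl ((b, 0) : PhaseSpace d n)) : a = b := by
  have hx : ∀ x : Basis d n, 𝕖 (a ⬝ᵥ x) = c * 𝕖 (b ⬝ᵥ x) := by
    intro x
    have := congrFun (congrFun h x) x
    rw [Matrix.smul_apply, weyl_apply hd, weyl_apply hd] at this
    simpa using this
  have hc : c = 1 := by simpa using (hx 0).symm
  funext i
  have := hx (Pi.single i 1)
  rw [hc, one_mul] at this
  simpa using ZMod.injective_stdAddChar this

/-- The state `U|0⟩` is an eigenvector of the operators `U T_{(a,0)} U†`, and for a Clifford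
operator `U` these are proportional to `dⁿ` different Heisenberg-Weyl operators. -/
lemma pow_le_card_weylStabilizer_of_isStabilizerState (hd : Odd d)
    {ψ : EuclideanSpace ℂ (Basis d n)} (hψ : ‖ψ‖ = 1) (h : IsStabilizerState ψ) :
    d ^ n ≤ Nat.card (weylStabilizer hd ψ.ofLp) := by
  have hψ' := star_dotProduct_self_of_norm_eq_one hψ
  obtain ⟨U, ⟨hU, hcl⟩, hproj⟩ := h
  have hUU : Uᴴ * U = 1 := hU.1
  have hψU : ∃ c : ℂ, ψ.ofLp = c • (U *ᵥ Pi.single 0 1) := by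
    have h1 : proj ψ *ᵥ ψ.ofLp = ψ.ofLp := by
      have : proj ψ = vecMulVec ψ.ofLp (star ψ.ofLp) := rfl
      rw [this, vecMulVec_mulVec, hψ']
      simp
    rw [hproj, proj_ket0_mulVec_conj, vecMulVec_mulVec] at h1
    exact ⟨_, h1.symm.trans (op_smul_eq_smul _ _)⟩
  obtain ⟨c, hc⟩ := hψU
  choose θ v hv using fun a : Basis d n => hcl (a, 0)
  have hv' : ∀ a, weyl ((a, 0) : PhaseSpace d n) =
      Complex.exp (θ a * Complex.I) • (Uᴴ * weyl (v a) * U) := by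
    intro a
    have := congrArg (fun M => Uᴴ * M * U) (hv a)
    simp only [Matrix.mul_smul, Matrix.smul_mul] at this
    rw [← this, Matrix.mul_assoc, Matrix.mul_assoc, hUU, Matrix.mul_one, ← Matrix.mul_assoc, hUU,
      Matrix.one_mul]
  have hmem : ∀ a, v a ∈ weylStabilizer hd ψ.ofLp := by
    intro a
    refine (mem_weylStabilizer hd hψ').2 ⟨(Complex.exp (θ a * Complex.I))⁻¹, ?_⟩
    rw [eq_inv_smul_iff₀ (Complex.exp_ne_zero _), ← smul_mulVec, ← hv, hc, mulVec_smul,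
      mulVec_mulVec, Matrix.mul_assoc, hUU, Matrix.mul_one, ← mulVec_mulVec,
      weyl_fst_mulVec_single hd]
  have hinj : Function.Injective v := by
    intro a b hab
    refine eq_of_weyl_fst_eq_smul hd
      (c := Complex.exp (θ a * Complex.I) * (Complex.exp (θ b * Complex.I))⁻¹) ?_
    rw [hv' a, hv' b, hab, smul_smul, inv_mul_cancel_right₀ (Complex.exp_ne_zero _)]
  have := Nat.card_le_card_of_injective (fun a => (⟨v a, hmem a⟩ : weylStabilizer hd ψ.ofLp))
    fun a b hab => hinj (congrArg Subtype.val hab)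
  simpa [Nat.card_eq_fintype_card, ZMod.card] using this

lemma exists_exp_mul_I_eq {c : ℂ} (hc : star c * c = 1) :
    ∃ θ : ℝ, Complex.exp (θ * Complex.I) = c := by
  have h : ‖c‖ = 1 := by
    have := congrArg norm hc
    rw [norm_mul, norm_star, norm_one] at this
    nlinarith [norm_nonneg c]
  refine ⟨c.arg, ?_⟩
  have := Complex.norm_mul_exp_arg_mul_I c
  rwa [h, Complex.ofReal_one, one_mul] at this

/-- The operator `|x⟩ ↦ T_{f(x)} ψ`. -/
def frameOp (ψ : Basis d n → ℂ) (f : Basis d n → PhaseSpace d n) : Op d n :=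
  Matrix.of fun y x => (weyl (f x) *ᵥ ψ) y

/-- A state whose stabilizer has at least `dⁿ` elements is a stabilizer state: for a symplectic
frame `(e, f)` with `e` in the stabilizer, the operator `|x⟩ ↦ T_{f(x)} ψ` is Clifford. -/
lemma isStabilizerState_of_pow_le_card (hd : Odd d)
    {ψ : EuclideanSpace ℂ (Basis d n)} (hψ : ‖ψ‖ = 1)
    (hcard : d ^ n ≤ Nat.card (weylStabilizer hd ψ.ofLp)) : IsStabilizerState ψ := by
  have hψ' := star_dotProduct_self_of_norm_eq_one hψ
  obtain ⟨e, f, he, hef, hff⟩ := exists_symplectic_frame hd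
    (fun u hu v hv => symp_eq_zero_of_mem_weylStabilizer hd hψ' hu hv) hcard
  choose c hc0 hc using he
  have hweyl_ff : ∀ b x, weyl (f b) * weyl (f x) = weyl (f (b + x)) := by
    intro b x
    rw [weyl_mul hd, hff, mul_zero, AddChar.map_zero_eq_one, one_smul, map_add]
  have hweyl_ef : ∀ a x, weyl (e a) *ᵥ (weyl (f x) *ᵥ ψ.ofLp) =
      (𝕖 (a ⬝ᵥ x) * c a) • (weyl (f x) *ᵥ ψ.ofLp) := by
    intro a x
    rw [mulVec_mulVec, weyl_mul_comm hd, hef, smul_mulVec, ← mulVec_mulVec, hc, mulVec_smul,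
      smul_smul]
  set U : Op d n := frameOp ψ.ofLp f with hUdef
  have hUcol : ∀ (M : Op d n) x y, (M * U) y x = (M *ᵥ (weyl (f x) *ᵥ ψ.ofLp)) y :=
    fun M x y => rfl
  have hUU : Uᴴ * U = 1 := by
    ext x y
    have h1 : (Uᴴ * U) x y =
        star (weyl (f x) *ᵥ ψ.ofLp) ⬝ᵥ (weyl (f y) *ᵥ ψ.ofLp) := rfl
    rw [h1]
    by_cases hxy : x = y
    · rw [hxy, star_dotProduct_mulVec_left, mulVec_mulVec, weyl_conjTranspose_mul_self hd,
        one_mulVec, hψ', Matrix.one_apply_eq]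
    · rw [Matrix.one_apply_ne hxy]
      obtain ⟨i, hi⟩ := Function.ne_iff.1 hxy
      -- The two vectors are eigenvectors of the unitary `T_{e(a)}` for different eigenvalues.
      set a : Basis d n := Pi.single i 1 with ha
      set z := star (weyl (f x) *ᵥ ψ.ofLp) ⬝ᵥ (weyl (f y) *ᵥ ψ.ofLp) with hz
      have h2 : star (weyl (e a) *ᵥ (weyl (f x) *ᵥ ψ.ofLp)) ⬝ᵥ
          (weyl (e a) *ᵥ (weyl (f y) *ᵥ ψ.ofLp)) = z := by
        rw [star_dotProduct_mulVec_left, mulVec_mulVec, weyl_conjTranspose_mul_self hd,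
          one_mulVec]
      rw [hweyl_ef, hweyl_ef, star_smul, smul_dotProduct, dotProduct_smul, ← hz, smul_eq_mul,
        smul_eq_mul, star_mul, star_stdAddChar] at h2
      have hcc := star_mul_self_eq_one_of_eigen (weyl_conjTranspose_mul_self hd (e a)) hψ' (hc a)
      have h3 : 𝕖 (-(a ⬝ᵥ x)) * 𝕖 (a ⬝ᵥ y) * z = z := by
        linear_combination h2 - 𝕖 (-(a ⬝ᵥ x)) * 𝕖 (a ⬝ᵥ y) * z * hcc
      by_contra hz0
      rw [← AddChar.map_add_eq_mul] at h3
      have h4 := mul_right_cancel₀ hz0 (h3.trans (one_mul z).symm)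
      rw [← AddChar.map_zero_eq_one (ZMod.stdAddChar : AddChar (ZMod d) ℂ)] at h4
      have h5 := ZMod.injective_stdAddChar h4
      simp only [ha, single_one_dotProduct] at h5
      exact hi (by linear_combination -h5)
  refine ⟨U, ⟨⟨hUU, mul_eq_one_comm.1 hUU⟩, ?_⟩, ?_⟩
  · rintro ⟨a, b⟩
    have hcc := star_mul_self_eq_one_of_eigen (weyl_conjTranspose_mul_self hd (e a)) hψ' (hc a)
    have hcomm : c a • (U * weyl ((a, b) : PhaseSpace d n)) = weyl (e a + f b) * U := by
      ext y x
      have h1 : (U * weyl ((a, b) : PhaseSpace d n)) y x =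
          U y (x + b) * 𝕖 (a ⬝ᵥ (x + b) - 2⁻¹ * (a ⬝ᵥ b)) := by
        simp only [Matrix.mul_apply, weyl_apply hd, mul_ite, mul_zero, Finset.sum_ite_eq',
          Finset.mem_univ, if_true]
      have h2 : weyl (e a + f b) = 𝕖 (2⁻¹ * (a ⬝ᵥ b)) • (weyl (f b) * weyl (e a)) := by
        rw [weyl_mul hd, symp_swap, hef, smul_smul, ← AddChar.map_add_eq_mul, add_comm (f b)]
        simp
      rw [Matrix.smul_apply, h1, hUcol, h2, smul_mulVec, ← mulVec_mulVec, hweyl_ef, mulVec_smul,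
        mulVec_mulVec, hweyl_ff, add_comm b x, smul_smul, ← mul_assoc, ← AddChar.map_add_eq_mul,
        dotProduct_add, Pi.smul_apply, smul_eq_mul, smul_eq_mul]
      have h3 : a ⬝ᵥ x + a ⬝ᵥ b - 2⁻¹ * (a ⬝ᵥ b) = 2⁻¹ * (a ⬝ᵥ b) + a ⬝ᵥ x := by
        linear_combination -(a ⬝ᵥ b) * two_mul_half hd
      rw [h3]
      change c a * ((weyl (f (x + b)) *ᵥ ψ.ofLp) y * _) = _
      ring
    obtain ⟨θ, hθ⟩ := exists_exp_mul_I_eq (c := star (c a)) (by rw [star_star, mul_comm, hcc])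
    refine ⟨θ, e a + f b, ?_⟩
    have hU' : U * Uᴴ = 1 := mul_eq_one_comm.1 hUU
    have h1 : U * weyl ((a, b) : PhaseSpace d n) = star (c a) • (weyl (e a + f b) * U) := by
      rw [← hcomm, smul_smul, hcc, one_smul]
    rw [hθ, h1, Matrix.smul_mul, Matrix.mul_assoc, hU', Matrix.mul_one]
  · have h1 : U *ᵥ Pi.single 0 1 = ψ.ofLp := by
      ext y
      rw [mulVec_single_one, Matrix.col_apply]
      change (weyl (f 0) *ᵥ ψ.ofLp) y = _
      rw [map_zero, weyl_zero hd, one_mulVec]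
    rw [proj_ket0_mulVec_conj, h1]
    rfl

end Qudit

end

theorem mainTheorem7 (d n : ℕ) [Fact d.Prime] (hd : Odd d)
    (ψ : EuclideanSpace ℂ (Qudit.Basis d n)) (hψ : ‖ψ‖ = 1) :
    (0 ≤ Qudit.logWignerRank ψ ∧ Qudit.logWignerRank ψ ≤ n * Real.logb 2 d) ∧
      (Qudit.logWignerRank ψ = 0 ↔ Qudit.IsStabilizerState ψ) := by
  have hd0 : (0 : ℝ) < d := Nat.cast_pos.2 (Fact.out : d.Prime).pos
  have hpow : (0 : ℝ) < (d : ℝ) ^ n := pow_pos hd0 n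
  have hle : (d : ℝ) ^ n ≤ Qudit.wignerRank ψ := by exact_mod_cast Qudit.pow_le_wignerRank hd hψ
  have hrank : (0 : ℝ) < Qudit.wignerRank ψ := hpow.trans_le hle
  have hub : (Qudit.wignerRank ψ : ℝ) ≤ (d : ℝ) ^ n * (d : ℝ) ^ n := by
    have h : Qudit.wignerRank ψ ≤ d ^ n * d ^ n := by
      refine (Set.ncard_le_card _).trans_eq ?_
      simp [Nat.card_eq_fintype_card, ZMod.card]
    exact_mod_cast h
  refine ⟨⟨sub_nonneg.2 (Real.logb_le_logb_of_le one_lt_two hpow hle), ?_⟩, ?_⟩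
  · have h := Real.logb_le_logb_of_le one_lt_two hrank hub
    rw [Real.logb_mul hpow.ne' hpow.ne'] at h
    rw [← Real.logb_pow, Qudit.logWignerRank]
    linarith
  · have hiff : Qudit.logWignerRank ψ = 0 ↔ Qudit.wignerRank ψ = d ^ n := by
      rw [Qudit.logWignerRank, sub_eq_zero]
      refine ⟨fun h => ?_, fun h => by rw [h, Nat.cast_pow]⟩
      exact_mod_cast Real.logb_injOn_pos one_lt_two hrank hpow h
    rw [hiff]
    refine ⟨fun h => Qudit.isStabilizerState_of_pow_le_card hd hψ
      (Qudit.pow_le_card_weylStabilizer_of_wignerRank_eq hd hψ h), fun h => le_antisymm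
      (Qudit.wignerRank_le_of_pow_le_card hd
        (Qudit.pow_le_card_weylStabilizer_of_isStabilizerState hd hψ h))
      (Qudit.pow_le_wignerRank hd hψ)⟩
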